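/- **Notation.** For a frame $L$, let $\mathsf S(L)^{\mathrm{op}}$ be the frame of all sublocales of $L$ (subsets $S\subseteq L$ closed under arbitrary meets and with $x\to s\in S$ for $x\in L$, $s\in S$), ordered by reverse inclusion; $a^{*}$ denotes the pseudocomplement of $a$. Let $\mathfrak L(\overline{\mathbb{IR}})$ be the frame generated by symbols $(r,-)$ and $(-,s)$, $r,s\in\mathbb Q$, subject to $(r,-)\wedge(-,s)=0$ for $r\ge s$, $(r,-)=\bigvee_{p>r}(p,-)$ and $(-,s)=\bigvee_{q<s}(-,q)$. Let $\overline{\mathrm F}(L)$ be the set of frame homomorphisms $f\colon\mathfrak L(\overline{\mathbb{IR}})\to\mathsf S(L)^{\mathrm{op}}$ such that $f(r,-)^{*}\le f(-,s)$ and $f(-,s)^{*}\le f(r,-)$ for all $r<s$, ordered by $f\le g$ iff $f(r,-)\le g(r,-)$ and $g(-,s)\le f(-,s)$ for all $r,s\in\mathbb Q$. Let $\boldsymbol{+\infty}$ (resp. $\boldsymbol{-\infty}$) be the element with $(r,-)\mapsto 1$, $(-,s)\mapsto 0$ (resp. $(r,-)\mapsto 0$, $(-,s)\mapsto 1$) for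 all $r,s$. Let $\mathrm F(L)$ be the subset of those $f\in\overline{\mathrm F}(L)$ such that, for all $g\in\overline{\mathrm F}(L)$, $f\vee g=\boldsymbol{+\infty}$ implies $g=\boldsymbol{+\infty}$, and $f\wedge g=\boldsymbol{-\infty}$ implies $g=\boldsymbol{-\infty}$ (join and meet in $\overline{\mathrm F}(L)$). An $f\in\overline{\mathrm F}(L)$ is extended lower (resp. upper) semicontinuous if $f(r,-)\vee f(-,s)=1$ for all $r<s$ and every $f(r,-)$ (resp. every $f(-,s)$) is a closed sublocale ${\uparrow}a$, $a\in L$; write $\overline{\mathrm{LSC}}(L)$, $\overline{\mathrm{USC}}(L)$ for the sets of these. For a topological space $X$ with frame of open sets $\mathcal OX$, let $\overline{\mathrm F}(X)$ and $\mathrm F(X)$ be the sets of all functions $X\to\overline{\mathbb R}=[-\infty,+\infty]$ and $X\to\mathbb R$, ordered pointwise, and $\overline{\mathrm{LSC}}(X),\overline{\mathrm{USC}}(X)\subseteq\overline{\mathrm F}(X)$ the sets of lower and upper semicontinuous functions. **Theorem.** Let $X$ be a $T_1$-space. Then: 1. The inclusion of $\overline{\mathrm{LSC}}(X)\cup\overline{\mathrm{USC}}(X)$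 in $\overline{\mathrm F}(X)$ is its Dedekind–MacNeille completion: every element of the complete lattice $\overline{\mathrm F}(X)$ is a join of elements of $\overline{\mathrm{LSC}}(X)\cup\overline{\mathrm{USC}}(X)$, and also a meet of such elements. 2. There is an order isomorphism (hence a lattice isomorphism) $e\colon\overline{\mathrm F}(X)\to\overline{\mathrm F}(\mathcal OX)$, and it can be chosen so that it maps $\overline{\mathrm{LSC}}(X)$ onto $\overline{\mathrm{LSC}}(\mathcal OX)$ and $\overline{\mathrm{USC}}(X)$ onto $\overline{\mathrm{USC}}(\mathcal OX)$. 3. This $e$ restricts to an order isomorphism $\mathrm F(X)\to\mathrm F(\mathcal OX)$. -/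

import Mathlib

namespace PointfreeReal

/-! ### Frames presented by generators and relations -/

/-- The free frame on a set `G` of generators: down-sets of the free meet-semilattice on `G`,
that is, of the finite subsets of `G` ordered by reverse inclusion. -/
abbrev FreeFrame (G : Type*) : Type _ := LowerSet (Finset G)ᵒᵈ

namespace FreeFrame

variable {G : Type*} {L : Type*} [Order.Frame L]

/-- The generator of the free frame given by an element of `G`. -/
def of (g : G) : FreeFrame G := LowerSet.Iic (OrderDual.toDual {g})

/-- The frame homomorphism out of the free frame determined by the images of the generators. -/
def lift (h : G → L) : FrameHom (FreeFrame G) L where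
  toFun U := ⨆ S : (Finset G)ᵒᵈ, ⨆ _ : S ∈ U, (OrderDual.ofDual S).inf h
  map_inf' U V := by
    classical
    apply le_antisymm
    · refine iSup₂_le fun S hS => le_inf ?_ ?_
      · exact le_iSup₂_of_le S hS.1 le_rfl
      · exact le_iSup₂_of_le S hS.2 le_rfl
    · rw [iSup₂_inf_eq]
      refine iSup₂_le fun S hS => ?_
      rw [inf_iSup₂_eq]
      refine iSup₂_le fun T hT => ?_
      rw [← Finset.inf_union]
      refine le_iSup₂_of_le (OrderDual.toDual (OrderDual.ofDual S ∪ OrderDual.ofDual T))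
        ⟨U.lower (a := S) ?_ hS, V.lower (a := T) ?_ hT⟩ le_rfl
      · exact Finset.subset_union_left
      · exact Finset.subset_union_right
  map_top' := by
    refine top_le_iff.1 (le_iSup₂_of_le (OrderDual.toDual ∅) trivial ?_)
    simp
  map_sSup' A := by
    apply le_antisymm
    · refine iSup₂_le fun S hS => ?_
      obtain ⟨U, hU, hSU⟩ := LowerSet.mem_sSup_iff.1 hS
      refine le_trans ?_ (le_sSup ⟨U, hU, rfl⟩)
      exact le_iSup₂_of_le S hSU le_rfl
    · refine sSup_le ?_
      rintro _ ⟨U, hU, rfl⟩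
      exact iSup₂_le fun S hS => le_iSup₂_of_le S (LowerSet.mem_sSup_iff.2 ⟨U, hU, hS⟩) le_rfl

theorem lift_of (h : G → L) (g : G) : lift h (of g) = h g := by
  apply le_antisymm
  · refine iSup₂_le fun S hS => ?_
    have hg : g ∈ OrderDual.ofDual S := Finset.singleton_subset_iff.1 hS
    exact Finset.inf_le hg
  · refine le_iSup₂_of_le (OrderDual.toDual {g}) ?_ ?_
    · exact le_refl (OrderDual.toDual ({g} : Finset G))
    · simp

/-- Frame homomorphisms out of the free frame are determined by the images of the generators. -/
theorem hom_ext {f f' : FrameHom (FreeFrame G) L} (h : ∀ g, f (of g) = f' (of g)) : f = f' := by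
  classical
  have h1 : ∀ S : Finset G, f (LowerSet.Iic (OrderDual.toDual S)) =
      f' (LowerSet.Iic (OrderDual.toDual S)) := by
    intro S
    induction S using Finset.induction_on with
    | empty =>
      have : LowerSet.Iic (OrderDual.toDual (∅ : Finset G)) = ⊤ := by
        ext T
        simp
      rw [this, map_top, map_top]
    | insert a S _ ih =>
      have : LowerSet.Iic (OrderDual.toDual (insert a S)) =
          of a ⊓ LowerSet.Iic (OrderDual.toDual S) := by
        ext T
        simp [of, Finset.insert_subset_iff]
      rw [this, map_inf, map_inf, h, ih]
  ext U
  have hU : U = ⨆ S : U, LowerSet.Iic (S : (Finset G)ᵒᵈ) := by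
    ext T
    simp only [SetLike.mem_coe, LowerSet.mem_iSup_iff, LowerSet.mem_Iic_iff]
    exact ⟨fun hT => ⟨⟨T, hT⟩, le_rfl⟩, fun ⟨S, hS⟩ => U.lower hS S.2⟩
  rw [hU, map_iSup, map_iSup]
  exact iSup_congr fun S => h1 (OrderDual.ofDual (S : (Finset G)ᵒᵈ))

end FreeFrame

/-- The sublocale of those elements `s` of a frame which do not separate the two sides of any
relation in `R`: `a ⊓ c ≤ s ↔ b ⊓ c ≤ s` for all `(a, b) ∈ R` and all `c`. As a frame, this is the
quotient of `F` by the frame congruence generated by `R`. -/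
def relSublocale {F : Type*} [Order.Frame F] (R : Set (F × F)) : Sublocale F where
  carrier := {s | ∀ p ∈ R, p.1 ⇨ s = p.2 ⇨ s}
  sInf_mem' := by
    intro A hA p hp
    simp only [sInf_eq_iInf, himp_iInf_eq]
    exact iInf_congr fun s => iInf_congr fun hs => hA hs p hp
  himp_mem' := by
    intro a b hb p hp
    rw [himp_left_comm, hb p hp, himp_left_comm]

/-- The frame presented by the generators `G` subject to the relations `R`
(a pair `(a, b)` of elements of the free frame stands for the relation `a = b`). -/
abbrev PresentedFrame {G : Type*} (R : Set (FreeFrame G × FreeFrame G)) : Type _ :=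
  relSublocale R

namespace PresentedFrame

variable {G : Type*} {R : Set (FreeFrame G × FreeFrame G)} {L : Type*} [Order.Frame L]

/-- The generators of a presented frame. -/
def of (R : Set (FreeFrame G × FreeFrame G)) (g : G) : PresentedFrame R :=
  (relSublocale R).restrict (FreeFrame.of g)

/-- Frame homomorphisms out of a presented frame are determined by the images of the
generators. -/
theorem hom_ext {f f' : FrameHom (PresentedFrame R) L} (h : ∀ g, f (of R g) = f' (of R g)) :
    f = f' := by
  have h1 : f.comp (relSublocale R).restrict = f'.comp (relSublocale R).restrict :=
    FreeFrame.hom_ext h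
  ext x
  have h2 := DFunLike.congr_fun h1 (x : FreeFrame G)
  simpa [Sublocale.restrict_of_mem] using h2

/-- An assignment on the generators that respects the relations. -/
def Respects (R : Set (FreeFrame G × FreeFrame G)) (h : G → L) : Prop :=
  ∀ p ∈ R, FreeFrame.lift h p.1 = FreeFrame.lift h p.2

theorem lift_restrict {h : G → L} (hh : Respects R h) (x : FreeFrame G) :
    FreeFrame.lift h ((relSublocale R).restrict x : PresentedFrame R) = FreeFrame.lift h x := by
  set φ := FreeFrame.lift h
  apply le_antisymm
  · -- the largest element of the free frame below the value of `x` is saturated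
    let k : FreeFrame G := sSup {y | φ y ≤ φ x}
    have hk : ∀ y, y ≤ k ↔ φ y ≤ φ x := by
      intro y
      refine ⟨fun hy => (OrderHomClass.mono φ hy).trans ?_, fun hy => le_sSup hy⟩
      rw [map_sSup]
      exact sSup_le (by rintro _ ⟨z, hz, rfl⟩; exact hz)
    have hmem : k ∈ relSublocale R := by
      intro p hp
      refine eq_of_forall_le_iff fun c => ?_
      rw [le_himp_iff, le_himp_iff, hk, hk, map_inf, map_inf, hh p hp]
    have : (relSublocale R).restrict x ≤ ⟨k, hmem⟩ :=
      ((relSublocale R).giRestrict.gc _ _).2 ((hk x).2 le_rfl)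
    exact (hk _).1 this
  · exact OrderHomClass.mono φ ((relSublocale R).giRestrict.gc.le_u_l x)

/-- The frame homomorphism out of a presented frame determined by an assignment on the generators
that respects the relations. -/
def lift (h : G → L) (hh : Respects R h) : FrameHom (PresentedFrame R) L where
  toFun x := FreeFrame.lift h (x : FreeFrame G)
  map_inf' x y := by simp
  map_top' := by
    have : ((⊤ : PresentedFrame R) : FreeFrame G) = ⊤ :=
      (relSublocale R).giRestrict.gc.u_top
    simp [this]
  map_sSup' A := by
    have hA : sSup A = (relSublocale R).restrict (sSup (Subtype.val '' A)) := by
      rw [map_sSup, Set.image_image]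
      simp
    rw [hA, lift_restrict hh, map_sSup, Set.image_image]

theorem lift_of (h : G → L) (hh : Respects R h) (g : G) : lift h hh (of R g) = h g :=
  (lift_restrict hh _).trans (FreeFrame.lift_of h g)

end PresentedFrame

/-! ### The frame of extended partial reals -/

/-- The generators `(r, —)` and `(—, s)`, for rational numbers `r`, `s`. -/
inductive Gen : Type
  | above (r : ℚ)
  | below (s : ℚ)

/-- The defining relations of the frame of extended partial reals:
`(r, —) ∧ (—, s) = 0` whenever `s ≤ r`, `(r, —) = ⋁_{r < p} (p, —)` and
`(—, s) = ⋁_{q < s} (—, q)`. -/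
inductive ExtPartialRel : FreeFrame Gen × FreeFrame Gen → Prop
  | disjoint (r s : ℚ) (h : s ≤ r) :
      ExtPartialRel (FreeFrame.of (Gen.above r) ⊓ FreeFrame.of (Gen.below s), ⊥)
  | above (r : ℚ) :
      ExtPartialRel (FreeFrame.of (Gen.above r),
        ⨆ p : ℚ, ⨆ _ : r < p, FreeFrame.of (Gen.above p))
  | below (s : ℚ) :
      ExtPartialRel (FreeFrame.of (Gen.below s),
        ⨆ q : ℚ, ⨆ _ : q < s, FreeFrame.of (Gen.below q))

/-- The frame of extended partial reals. -/
abbrev ExtPartialReals : Type := PresentedFrame {p | ExtPartialRel p}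

/-- The element `(r, —)`. -/
def above (r : ℚ) : ExtPartialReals := PresentedFrame.of _ (Gen.above r)

/-- The element `(—, s)`. -/
def below (s : ℚ) : ExtPartialReals := PresentedFrame.of _ (Gen.below s)

/-! ### Continuous extended partial real functions on a frame -/

/-- A continuous extended partial real function on a frame `L`: a frame homomorphism from the
frame of extended partial reals to `L`. -/
structure ExtPartialFun (L : Type*) [Order.Frame L] where
  /-- The underlying frame homomorphism. -/
  toHom : FrameHom ExtPartialReals L

namespace ExtPartialFun

variable {L : Type*} [Order.Frame L]

/-- `f ≤ g` iff `f(r, —) ≤ g(r, —)` and `g(—, s) ≤ f(—, s)` for all rational `r`, `s`. -/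
instance : PartialOrder (ExtPartialFun L) where
  le f g := (∀ r, f.toHom (above r) ≤ g.toHom (above r)) ∧
    ∀ s, g.toHom (below s) ≤ f.toHom (below s)
  le_refl f := ⟨fun _ => le_rfl, fun _ => le_rfl⟩
  le_trans f g h hfg hgh :=
    ⟨fun r => (hfg.1 r).trans (hgh.1 r), fun s => (hgh.2 s).trans (hfg.2 s)⟩
  le_antisymm f g hfg hgf := by
    obtain ⟨f⟩ := f
    obtain ⟨g⟩ := g
    congr 1
    refine PresentedFrame.hom_ext fun x => ?_
    cases x with
    | above r => exact le_antisymm (hfg.1 r) (hgf.1 r)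
    | below s => exact le_antisymm (hgf.2 s) (hfg.2 s)

/-- The assignment on generators that takes the value `a` at all `(r, —)` and `b` at all
`(—, s)`. -/
def constGen (a b : L) : Gen → L
  | Gen.above _ => a
  | Gen.below _ => b

theorem respects_constGen (a b : L) (hab : a ⊓ b = ⊥) :
    PresentedFrame.Respects {p | ExtPartialRel p} (constGen a b) := by
  rintro _ (⟨r, s, h⟩ | ⟨r⟩ | ⟨s⟩)
  · simp only [map_inf, map_bot, FreeFrame.lift_of]
    exact hab
  · simp only [map_iSup, FreeFrame.lift_of]
    obtain ⟨p, hp⟩ := exists_gt r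
    exact le_antisymm (le_iSup₂_of_le p hp le_rfl) (iSup₂_le fun _ _ => le_rfl)
  · simp only [map_iSup, FreeFrame.lift_of]
    obtain ⟨q, hq⟩ := exists_lt s
    exact le_antisymm (le_iSup₂_of_le q hq le_rfl) (iSup₂_le fun _ _ => le_rfl)

/-- The function that is constantly `a` on all `(r, —)` and constantly `b` on all `(—, s)`,
for disjoint `a` and `b`. -/
def const (a b : L) (hab : a ⊓ b = ⊥) : ExtPartialFun L where
  toHom := PresentedFrame.lift (constGen a b) (respects_constGen a b hab)

@[simp] theorem const_above (a b : L) (hab : a ⊓ b = ⊥) (r : ℚ) :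
    (const a b hab).toHom (above r) = a :=
  PresentedFrame.lift_of _ (respects_constGen a b hab) _

@[simp] theorem const_below (a b : L) (hab : a ⊓ b = ⊥) (s : ℚ) :
    (const a b hab).toHom (below s) = b :=
  PresentedFrame.lift_of _ (respects_constGen a b hab) _

/-- Hausdorff continuity: `f(r, —)* ≤ f(—, s)` and `f(—, s)* ≤ f(r, —)` whenever `r < s`. -/
def IsHausdorff (f : ExtPartialFun L) : Prop :=
  ∀ r s : ℚ, r < s →
    (f.toHom (above r))ᶜ ≤ f.toHom (below s) ∧ (f.toHom (below s))ᶜ ≤ f.toHom (above r)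

/-- `f` is a continuous extended real function, that is, `f(r, —) ∨ f(—, s) = 1` whenever
`r < s`. -/
def IsContinuous (f : ExtPartialFun L) : Prop :=
  ∀ r s : ℚ, r < s → f.toHom (above r) ⊔ f.toHom (below s) = ⊤

end ExtPartialFun

/-- The Hausdorff continuous extended partial real functions on `L`. -/
abbrev HausdorffFun (L : Type*) [Order.Frame L] : Type _ :=
  {f : ExtPartialFun L // f.IsHausdorff}

/-! ### Arbitrary (extended) real functions on a frame -/

/-- The frame of all sublocales of `L`, ordered by reverse inclusion. -/
abbrev CoSub (L : Type*) [Order.Frame L] : Type _ := (Sublocale L)ᵒᵈ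

/-- The closed sublocale `↑a`. -/
def closedSublocale {L : Type*} [Order.Frame L] (a : L) : Sublocale L where
  carrier := Set.Ici a
  sInf_mem' _ hs := le_sInf hs
  himp_mem' _ _ hb := le_trans hb le_himp

/-- Arbitrary extended real functions on a frame `L`. -/
abbrev ExtRealFun (L : Type*) [Order.Frame L] : Type _ := HausdorffFun (CoSub L)

namespace ExtRealFun

variable {L : Type*} [Order.Frame L]

/-- The constant function `+∞`: it takes the value `1` at all `(r, —)` and `0` at all `(—, s)`. -/
def plusInfty (L : Type*) [Order.Frame L] : ExtRealFun L :=
  ⟨.const ⊤ ⊥ (by simp), fun r s _ => by simp⟩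

/-- The constant function `-∞`: it takes the value `0` at all `(r, —)` and `1` at all `(—, s)`. -/
def minusInfty (L : Type*) [Order.Frame L] : ExtRealFun L :=
  ⟨.const ⊥ ⊤ (by simp), fun r s _ => by simp⟩

/-- `f` is real-valued: `f ∨ g = +∞` implies `g = +∞`, and `f ∧ g = -∞` implies `g = -∞`,
joins and meets being taken in the poset of all arbitrary extended real functions on `L`. -/
def IsRealValued (f : ExtRealFun L) : Prop :=
  (∀ g, IsLUB {f, g} (plusInfty L) → g = plusInfty L) ∧
    ∀ g, IsGLB {f, g} (minusInfty L) → g = minusInfty L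

/-- `f` is an extended lower semicontinuous function on the frame `L`: a continuous extended real
function on the frame of sublocales such that all `f(r, —)` are closed sublocales. -/
def IsLowerSemicontinuous (f : ExtRealFun L) : Prop :=
  f.1.IsContinuous ∧ ∀ r, ∃ a : L, f.1.toHom (above r) = OrderDual.toDual (closedSublocale a)

/-- `f` is an extended upper semicontinuous function on the frame `L`: a continuous extended real
function on the frame of sublocales such that all `f(—, s)` are closed sublocales. -/
def IsUpperSemicontinuous (f : ExtRealFun L) : Prop :=
  f.1.IsContinuous ∧ ∀ s, ∃ a : L, f.1.toHom (below s) = OrderDual.toDual (closedSublocale a)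

end ExtRealFun

/-- Arbitrary real functions on a frame `L`: the real-valued arbitrary extended real functions. -/
abbrev RealFun (L : Type*) [Order.Frame L] : Type _ := {f : ExtRealFun L // f.IsRealValued}

/-! ### Dedekind–MacNeille completions -/

/-- An order embedding of a poset into a complete lattice is a Dedekind–MacNeille completion if it
is join-dense and meet-dense. -/
structure IsDedekindMacNeilleCompletion {P M : Type*} [PartialOrder P] [CompleteLattice M]
    (φ : P ↪o M) : Prop where
  join_dense : ∀ m : M, ∃ A : Set P, m = sSup (φ '' A)
  meet_dense : ∀ m : M, ∃ A : Set P, m = sInf (φ '' A)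

end PointfreeReal

namespace PointfreeReal

open TopologicalSpace

/-! ### Continuous extended partial real functions from their values on the generators -/

namespace ExtPartialFun

variable {L : Type*} [Order.Frame L]

/-! In a `T₁`-space each complement of a point is a coatom of the frame of opens, and every open set
is a meet of such coatoms. Sending a sublocale to the set of points whose coatom it omits gives a
frame homomorphism `omitted` from the dual of the sublocale lattice onto the power set of `X`. It
has a right adjoint section `coinduced` and is dense: only the bottom omits nothing. Hence
pseudocomplements are computed on sets (`compl_eq_coinduced`), and the power set is the
Booleanization of that frame. Hausdorff continuity expresses the values of `f` by pseudocomplements,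
so `f` is recovered from the omitted sets of its values (`ExtRealFun.above_eq_iSup`,
`ExtRealFun.below_eq_iSup`). These sets are the level sets of a function into `EReal`
(`exists_level_eq`), and every function arises this way; this is `representIso`. Semicontinuity
transfers because `coinduced` sends an open set `U` to `↑U`. Real-valuedness is purely
order-theoretic, so it transfers along the isomorphism. Density of the semicontinuous functions
needs only functions that are constant `⊥` or `⊤` off one point. -/

/-- The assignment on generators given by its values on the `(r, —)` and on the `(—, s)`. -/
def valueGen (a b : ℚ → L) : Gen → L
  | Gen.above r => a r
  | Gen.below s => b s

theorem respects_valueGen {a b : ℚ → L} (hab : ∀ r s, s ≤ r → a r ⊓ b s = ⊥)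
    (ha : ∀ r, a r = ⨆ p : ℚ, ⨆ _ : r < p, a p) (hb : ∀ s, b s = ⨆ q : ℚ, ⨆ _ : q < s, b q) :
    PresentedFrame.Respects {p | ExtPartialRel p} (valueGen a b) := by
  rintro _ (⟨r, s, h⟩ | ⟨r⟩ | ⟨s⟩)
  · simp only [map_inf, map_bot, FreeFrame.lift_of]
    exact hab r s h
  · simp only [map_iSup, FreeFrame.lift_of]
    exact ha r
  · simp only [map_iSup, FreeFrame.lift_of]
    exact hb s

theorem exists_hom_of_values {a b : ℚ → L} (hab : ∀ r s, s ≤ r → a r ⊓ b s = ⊥)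
    (ha : ∀ r, a r = ⨆ p : ℚ, ⨆ _ : r < p, a p) (hb : ∀ s, b s = ⨆ q : ℚ, ⨆ _ : q < s, b q) :
    ∃ f : ExtPartialFun L, (∀ r, f.toHom (above r) = a r) ∧ ∀ s, f.toHom (below s) = b s :=
  ⟨⟨PresentedFrame.lift _ (respects_valueGen hab ha hb)⟩,
    fun _ => PresentedFrame.lift_of _ (respects_valueGen hab ha hb) _,
    fun _ => PresentedFrame.lift_of _ (respects_valueGen hab ha hb) _⟩

/-- By construction no element of `relSublocale` separates the two sides of a relation, so their
reflections have the same upper bounds there. -/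
theorem relation_eq (f : ExtPartialFun L) {p : FreeFrame Gen × FreeFrame Gen}
    (hp : ExtPartialRel p) :
    f.toHom ((relSublocale {p | ExtPartialRel p}).restrict p.1) =
      f.toHom ((relSublocale {p | ExtPartialRel p}).restrict p.2) := by
  congr 1
  refine eq_of_forall_ge_iff fun c => ?_
  have gc := (relSublocale {p | ExtPartialRel p}).giRestrict.gc
  have h : p.1 ⇨ (c : FreeFrame Gen) = p.2 ⇨ (c : FreeFrame Gen) := c.2 p hp
  rw [gc.le_iff_le, gc.le_iff_le, ← himp_eq_top_iff, h, himp_eq_top_iff]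

theorem above_inf_below (f : ExtPartialFun L) {r s : ℚ} (h : s ≤ r) :
    f.toHom (above r) ⊓ f.toHom (below s) = ⊥ := by
  have := f.relation_eq (.disjoint r s h)
  simp only [map_inf, map_bot] at this
  exact this

theorem above_eq_iSup (f : ExtPartialFun L) (r : ℚ) :
    f.toHom (above r) = ⨆ p : ℚ, ⨆ _ : r < p, f.toHom (above p) := by
  have := f.relation_eq (.above r)
  simp only [map_iSup] at this
  exact this

theorem below_eq_iSup (f : ExtPartialFun L) (s : ℚ) :
    f.toHom (below s) = ⨆ q : ℚ, ⨆ _ : q < s, f.toHom (below q) := by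
  have := f.relation_eq (.below s)
  simp only [map_iSup] at this
  exact this

theorem le_iff {f g : ExtPartialFun L} : f ≤ g ↔
    (∀ r, f.toHom (above r) ≤ g.toHom (above r)) ∧ ∀ s, g.toHom (below s) ≤ f.toHom (below s) :=
  Iff.rfl

theorem ext_of_values {f g : ExtPartialFun L} (h : ∀ r, f.toHom (above r) = g.toHom (above r))
    (h' : ∀ s, f.toHom (below s) = g.toHom (below s)) : f = g :=
  le_antisymm (le_iff.2 ⟨fun r => (h r).le, fun s => (h' s).ge⟩)
    (le_iff.2 ⟨fun r => (h r).ge, fun s => (h' s).le⟩)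

end ExtPartialFun

/-! ### Subsets of a `T₁`-space and sublocales of its frame of open sets -/

section Points

variable {X : Type*} [TopologicalSpace X]

/-- The sublocale of the frame of open sets induced by a subset of the space. -/
def inducedSublocale (A : Set X) : Sublocale (Opens X) where
  carrier := {U | ∀ V : Opens X, (V : Set X) ∩ A ⊆ U → V ≤ U}
  sInf_mem' B hB V hV := le_sInf fun U hU =>
    hB hU V (hV.trans (SetLike.coe_subset_coe.2 (sInf_le hU)))
  himp_mem' W U hU V hV := by
    refine le_himp_iff.2 (hU _ ?_)
    rintro x ⟨⟨hxV, hxW⟩, hxA⟩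
    have h : (W ⇨ U) ⊓ W ≤ U := himp_inf_le
    exact h ⟨hV ⟨hxV, hxA⟩, hxW⟩

theorem mem_inducedSublocale {A : Set X} {U : Opens X} :
    U ∈ inducedSublocale A ↔ ∀ V : Opens X, (V : Set X) ∩ A ⊆ U → V ≤ U := Iff.rfl

theorem mem_closedSublocale {L : Type*} [Order.Frame L] {a b : L} :
    b ∈ closedSublocale a ↔ a ≤ b := Iff.rfl

/-- Joins in the dual order are intersections of sublocales, and lying above every `a i` means lying
above their join. -/
theorem iSup_toDual_closedSublocale {L : Type*} {ι : Sort*} [Order.Frame L] (a : ι → L) :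
    ⨆ i, OrderDual.toDual (closedSublocale (a i)) =
      OrderDual.toDual (closedSublocale (⨆ i, a i)) := by
  apply le_antisymm
  · exact iSup_le fun i x hx => (le_iSup a i).trans hx
  · intro x hx
    refine mem_closedSublocale.2 (iSup_le fun i => ?_)
    exact le_iSup (fun i => OrderDual.toDual (closedSublocale (a i))) i hx

/-- The open sublocale of the elements `s` with `a ⇨ s = s`. -/
def openSublocale {L : Type*} [Order.Frame L] (a : L) : Sublocale L where
  carrier := {s | a ⇨ s = s}
  sInf_mem' A hA := by
    simp only [Set.mem_ofPred_eq, sInf_eq_iInf, himp_iInf_eq]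
    exact iInf_congr fun s => iInf_congr fun hs => hA hs
  himp_mem' x s hs := by
    have hs' : a ⇨ s = s := hs
    rw [Set.mem_ofPred_eq, himp_left_comm, hs']

theorem mem_openSublocale {L : Type*} [Order.Frame L] {a b : L} :
    b ∈ openSublocale a ↔ a ⇨ b = b := Iff.rfl

/-- A sublocale omits a maximal element iff it lies in the corresponding open sublocale. -/
theorem le_openSublocale_iff_of_isCoatom {L : Type*} [Order.Frame L] {S : Sublocale L} {m : L}
    (hm : IsCoatom m) : S ≤ openSublocale m ↔ m ∉ S := by
  constructor
  · intro h hmS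
    have := mem_openSublocale.1 (h hmS)
    rw [himp_self] at this
    exact hm.1 this.symm
  · intro hmS s hs
    refine mem_openSublocale.2 (le_antisymm ?_ le_himp)
    -- This element of `S` lies above the coatom `m`, so it is `m` or `⊤`. Omission of `m` leaves
    -- `⊤`, that is, `m ⇨ s ≤ s`.
    have hmem : (m ⇨ s) ⇨ s ∈ S := S.himp_mem hs
    have hle : m ≤ (m ⇨ s) ⇨ s := le_himp_iff.2 inf_himp_le
    rcases hm.le_iff.1 hle with h | h
    · exact himp_eq_top_iff.1 h
    · exact absurd (h ▸ hmem) hmS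

/-- The sublocale induced by the complement of a set, in the dual order. -/
def coinduced (A : Set X) : CoSub (Opens X) := OrderDual.toDual (inducedSublocale Aᶜ)

theorem coinduced_empty : coinduced (∅ : Set X) = ⊥ := by
  refine le_bot_iff.1 fun U _ => mem_inducedSublocale.2 fun V hV => ?_
  simpa using hV

/-- A common element `W` of the two sublocales contains `U`, hence `Bᶜ`; being induced from `Bᶜ`, it
is then the whole space. -/
theorem coinduced_sup_eq_top {U : Opens X} {B : Set X} (h : Bᶜ ⊆ (U : Set X)) :
    OrderDual.toDual (closedSublocale U) ⊔ coinduced B = ⊤ := by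
  refine top_le_iff.1 ?_
  change closedSublocale U ⊓ inducedSublocale Bᶜ ≤ (⊥ : Sublocale (Opens X))
  intro W hW
  have h1 : U ≤ W := mem_closedSublocale.1 ((inf_le_left : _ ≤ closedSublocale U) hW)
  have h2 : W ∈ inducedSublocale Bᶜ := (inf_le_right : _ ≤ inducedSublocale Bᶜ) hW
  have h3 : W = ⊤ := top_le_iff.1 (mem_inducedSublocale.1 h2 ⊤ fun x hx => h1 (h hx.2))
  exact h3 ▸ Sublocale.top_mem

variable [T1Space X]

/-- The complement of a point, as an open set. -/
def pointCompl (x : X) : Opens X := ⟨{x}ᶜ, isOpen_compl_singleton⟩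

theorem le_pointCompl {U : Opens X} {x : X} : U ≤ pointCompl x ↔ x ∉ U :=
  Set.subset_compl_singleton_iff

theorem isCoatom_pointCompl (x : X) : IsCoatom (pointCompl x) := by
  refine ⟨fun h => le_pointCompl.1 h.ge trivial, fun U hU => ?_⟩
  have hx : x ∈ U := by
    by_contra hx
    exact hU.not_ge (le_pointCompl.2 hx)
  refine top_le_iff.1 fun y _ => ?_
  by_cases hy : y = x
  · exact hy ▸ hx
  · exact hU.le hy

/-- This is why a subset of a `T₁`-space can be recovered from its induced sublocale. -/
theorem pointCompl_mem_inducedSublocale {A : Set X} {x : X} :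
    pointCompl x ∈ inducedSublocale A ↔ x ∈ A := by
  constructor
  · intro h
    by_contra hx
    refine le_pointCompl.1 (mem_inducedSublocale.1 h ⊤ ?_) trivial
    rintro y ⟨-, hy⟩ rfl
    exact hx hy
  · exact fun hx V hV => le_pointCompl.2 fun hxV =>
      (hV (Set.mem_inter hxV hx) : x ∈ pointCompl x) rfl

/-- The point complements at points of `A` generate the induced sublocale: each of its elements `U`
is the meet of those at the points of `A` outside `U`. -/
theorem inducedSublocale_le_iff {A : Set X} {S : Sublocale (Opens X)} :
    inducedSublocale A ≤ S ↔ ∀ x ∈ A, pointCompl x ∈ S := by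
  refine ⟨fun h x hx => h (pointCompl_mem_inducedSublocale.2 hx), fun h U hU => ?_⟩
  have : U = sInf {V | ∃ x ∈ A, x ∉ U ∧ V = pointCompl x} := by
    apply le_antisymm
    · refine le_sInf ?_
      rintro _ ⟨x, -, hxU, rfl⟩
      exact le_pointCompl.2 hxU
    · refine hU _ ?_
      rintro x ⟨hx, hxA⟩
      by_contra hxU
      have hmem : pointCompl x ∈ {V | ∃ x ∈ A, x ∉ U ∧ V = pointCompl x} := ⟨x, hxA, hxU, rfl⟩
      exact le_pointCompl.1 (sInf_le hmem) hx
  rw [this]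
  refine S.sInf_mem ?_
  rintro _ ⟨x, hxA, -, rfl⟩
  exact h x hxA

theorem setOf_pointCompl_notMem_subset_iff {S : CoSub (Opens X)} {B : Set X} :
    {x | pointCompl x ∉ OrderDual.ofDual S} ⊆ B ↔ S ≤ coinduced B := by
  refine Iff.trans ?_ inducedSublocale_le_iff.symm
  refine forall_congr' fun x => ?_
  exact ⟨fun h hx => by_contra fun hS => hx (h hS), fun h hS => by_contra fun hx => hS (h hx)⟩

/-- The frame homomorphism that takes a sublocale to the set of the points it omits. -/
def omitted : FrameHom (CoSub (Opens X)) (Set X) where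
  toFun S := {x | pointCompl x ∉ OrderDual.ofDual S}
  map_inf' S T := by
    ext x
    have h := fun S : Sublocale (Opens X) =>
      -- Meets here are joins of sublocales, whose members are awkward to describe; writing omission
      -- of a coatom as an inequality reduces the claim to `sup_le_iff`.
      le_openSublocale_iff_of_isCoatom (S := S) (isCoatom_pointCompl x)
    exact (h _).symm.trans (sup_le_iff.trans (and_congr (h _) (h _)))
  map_top' := by
    ext x
    simp [← le_openSublocale_iff_of_isCoatom (isCoatom_pointCompl x)]
  map_sSup' A := by
    refine eq_of_forall_ge_iff fun B => ?_
    refine setOf_pointCompl_notMem_subset_iff.trans ?_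
    rw [sSup_le_iff, sSup_le_iff, Set.forall_mem_image]
    exact forall₂_congr fun S _ => setOf_pointCompl_notMem_subset_iff.symm

theorem mem_omitted {S : CoSub (Opens X)} {x : X} :
    x ∈ omitted S ↔ pointCompl x ∉ OrderDual.ofDual S := Iff.rfl

theorem gc_omitted_coinduced : GaloisConnection (omitted (X := X)) coinduced :=
  fun _ _ => setOf_pointCompl_notMem_subset_iff

theorem omitted_coinduced (A : Set X) : omitted (coinduced A) = A := by
  ext x
  rw [mem_omitted]
  exact pointCompl_mem_inducedSublocale.not.trans (by simp)

/-- Density of `omitted`: disjointness of sublocales in the dual order can be tested on points. -/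
theorem omitted_eq_empty_iff {S : CoSub (Opens X)} : omitted S = ∅ ↔ S = ⊥ := by
  rw [← le_bot_iff (a := S), ← coinduced_empty, ← gc_omitted_coinduced.le_iff_le]
  exact Set.subset_empty_iff.symm

/-- Pseudocomplements in the dual of the lattice of sublocales are coinduced. -/
theorem compl_eq_coinduced (S : CoSub (Opens X)) : Sᶜ = coinduced (omitted S)ᶜ := by
  refine eq_of_forall_le_iff fun T => ?_
  rw [le_compl_iff_disjoint_right, disjoint_iff, ← omitted_eq_empty_iff, map_inf,
    ← gc_omitted_coinduced.le_iff_le]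
  exact Set.disjoint_iff_inter_eq_empty.symm.trans Set.subset_compl_iff_disjoint_right.symm

/-- If `W` contains `U` and also `V` outside `U`, it contains all of `V`. This links open level sets
to closed sublocales. -/
theorem coinduced_coe (U : Opens X) : coinduced (U : Set X) =
    OrderDual.toDual (closedSublocale U) := by
  refine congrArg OrderDual.toDual (le_antisymm ?_ ?_)
  · exact inducedSublocale_le_iff.2 fun x hx => le_pointCompl.2 hx
  · intro W hW V hV x hx
    by_cases hxU : x ∈ U
    · exact mem_closedSublocale.1 hW hxU
    · exact hV ⟨hx, hxU⟩

theorem omitted_closedSublocale (U : Opens X) :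
    omitted (OrderDual.toDual (closedSublocale U)) = (U : Set X) := by
  rw [← coinduced_coe, omitted_coinduced]

end Points

/-! ### Level sets of extended real functions -/

section LevelSets

variable {X : Type*}

theorem ratCast_lt {r s : ℚ} : ((r : ℝ) : EReal) < ((s : ℝ) : EReal) ↔ r < s := by
  rw [EReal.coe_lt_coe_iff, Rat.cast_lt]

/-- The set where an extended real function exceeds a rational number. -/
def superlevel (φ : X → EReal) (r : ℚ) : Set X := {x | ((r : ℝ) : EReal) < φ x}

/-- The set where an extended real function is below a rational number. -/
def sublevel (φ : X → EReal) (s : ℚ) : Set X := {x | φ x < ((s : ℝ) : EReal)}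

theorem mem_superlevel {φ : X → EReal} {r : ℚ} {x : X} :
    x ∈ superlevel φ r ↔ ((r : ℝ) : EReal) < φ x := Iff.rfl

theorem mem_sublevel {φ : X → EReal} {s : ℚ} {x : X} :
    x ∈ sublevel φ s ↔ φ x < ((s : ℝ) : EReal) := Iff.rfl

theorem superlevel_eq_iSup (φ : X → EReal) (r : ℚ) :
    superlevel φ r = ⨆ p : ℚ, ⨆ _ : r < p, superlevel φ p := by
  ext x
  simp only [Set.iSup_eq_iUnion, Set.mem_iUnion, mem_superlevel, exists_prop]
  rw [EReal.lt_iff_exists_rat_btwn]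
  exact exists_congr fun p => and_congr_left' ratCast_lt

theorem sublevel_eq_iSup (φ : X → EReal) (s : ℚ) :
    sublevel φ s = ⨆ q : ℚ, ⨆ _ : q < s, sublevel φ q := by
  ext x
  simp only [Set.iSup_eq_iUnion, Set.mem_iUnion, mem_sublevel, exists_prop]
  rw [EReal.lt_iff_exists_rat_btwn]
  exact exists_congr fun q => and_comm.trans (and_congr_left' ratCast_lt)

theorem superlevel_inter_sublevel (φ : X → EReal) {r s : ℚ} (h : s ≤ r) :
    superlevel φ r ∩ sublevel φ s = ∅ := by
  refine Set.eq_empty_of_forall_notMem fun x hx => ?_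
  exact (ratCast_lt.1 (hx.1.trans hx.2)).not_ge h

theorem compl_superlevel_subset (φ : X → EReal) {r s : ℚ} (h : r < s) :
    (superlevel φ r)ᶜ ⊆ sublevel φ s := fun _ hx =>
  (not_lt.1 (mem_superlevel.not.1 hx)).trans_lt (ratCast_lt.2 h)

theorem compl_sublevel_subset (φ : X → EReal) {r s : ℚ} (h : r < s) :
    (sublevel φ s)ᶜ ⊆ superlevel φ r := fun _ hx =>
  (ratCast_lt.2 h).trans_le (not_lt.1 (mem_sublevel.not.1 hx))

theorem superlevel_mono {φ ψ : X → EReal} (h : φ ≤ ψ) (r : ℚ) :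
    superlevel φ r ⊆ superlevel ψ r := fun x hx => hx.trans_le (h x)

theorem sublevel_anti {φ ψ : X → EReal} (h : φ ≤ ψ) (s : ℚ) :
    sublevel ψ s ⊆ sublevel φ s := fun x hx => (h x).trans_lt hx

theorem le_of_superlevel_subset {φ ψ : X → EReal} (h : ∀ r, superlevel φ r ⊆ superlevel ψ r) :
    φ ≤ ψ := by
  refine fun x => not_lt.1 fun hx => ?_
  obtain ⟨r, h1, h2⟩ := EReal.lt_iff_exists_rat_btwn.1 hx
  exact lt_asymm h1 (h r h2)

/-- Families of sets that behave like the level sets of an extended real function are the level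
sets of one. -/
theorem exists_level_eq {A B : ℚ → Set X} (hAB : ∀ r s, s ≤ r → A r ∩ B s = ∅)
    (hA : ∀ r, A r = ⨆ p : ℚ, ⨆ _ : r < p, A p) (hB : ∀ s, B s = ⨆ q : ℚ, ⨆ _ : q < s, B q)
    (hcompl : ∀ r s, r < s → (A r)ᶜ ⊆ B s) :
    ∃ φ : X → EReal, superlevel φ = A ∧ sublevel φ = B := by
  have hA' : ∀ x r, x ∈ A r ↔ ∃ p, r < p ∧ x ∈ A p := by
    intro x r
    conv_lhs => rw [hA r]
    simp only [Set.iSup_eq_iUnion, Set.mem_iUnion, exists_prop]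
  have hB' : ∀ x s, x ∈ B s ↔ ∃ q, q < s ∧ x ∈ B q := by
    intro x s
    conv_lhs => rw [hB s]
    simp only [Set.iSup_eq_iUnion, Set.mem_iUnion, exists_prop]
  refine ⟨fun x => ⨆ p : ℚ, ⨆ _ : x ∈ A p, ((p : ℝ) : EReal), ?_, ?_⟩
  · ext r x
    rw [mem_superlevel, hA' x r]
    simp only [lt_iSup_iff, exists_prop, ratCast_lt]
    exact exists_congr fun p => and_comm
  · ext s x
    rw [mem_sublevel]
    constructor
    · intro h
      obtain ⟨q, h1, h2⟩ := EReal.lt_iff_exists_rat_btwn.1 h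
      -- The rational `q` strictly exceeds the supremum at `x`, so `x ∉ A q`.
      refine hcompl q s (ratCast_lt.1 h2) fun hq => ?_
      exact h1.not_ge (le_iSup₂_of_le q hq le_rfl)
    · intro h
      -- Disjointness only bounds the supremum by an index of `B`; moving down to `q < s` makes the
      -- inequality strict.
      obtain ⟨q, hqs, hq⟩ := (hB' x s).1 h
      refine lt_of_le_of_lt (iSup₂_le fun p hp => ?_) (ratCast_lt.2 hqs)
      refine not_lt.1 fun hqp => ?_
      have : x ∈ A p ∩ B q := ⟨hp, hq⟩
      rw [hAB p q (ratCast_lt.1 hqp).le] at this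
      exact this

variable [TopologicalSpace X]

theorem lowerSemicontinuous_iff_superlevel {φ : X → EReal} :
    LowerSemicontinuous φ ↔ ∀ r, IsOpen (superlevel φ r) := by
  rw [lowerSemicontinuous_iff_isOpen_preimage]
  refine ⟨fun h r => h _, fun h y => ?_⟩
  have : φ ⁻¹' Set.Ioi y = ⋃ r : ℚ, ⋃ _ : y < ((r : ℝ) : EReal), superlevel φ r := by
    ext x
    simp only [Set.mem_preimage, Set.mem_Ioi, Set.mem_iUnion, mem_superlevel, exists_prop]
    exact EReal.lt_iff_exists_rat_btwn
  rw [this]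
  exact isOpen_iUnion fun r => isOpen_iUnion fun _ => h r

theorem upperSemicontinuous_iff_sublevel {φ : X → EReal} :
    UpperSemicontinuous φ ↔ ∀ s, IsOpen (sublevel φ s) := by
  rw [upperSemicontinuous_iff_isOpen_preimage]
  refine ⟨fun h r => h _, fun h y => ?_⟩
  have : φ ⁻¹' Set.Iio y = ⋃ r : ℚ, ⋃ _ : ((r : ℝ) : EReal) < y, sublevel φ r := by
    ext x
    simp only [Set.mem_preimage, Set.mem_Iio, Set.mem_iUnion, mem_sublevel, exists_prop]
    exact EReal.lt_iff_exists_rat_btwn.trans (exists_congr fun _ => and_comm)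
  rw [this]
  exact isOpen_iUnion fun r => isOpen_iUnion fun _ => h r

end LevelSets

/-! ### Extended real functions on a `T₁`-space and on its frame of open sets -/

section Representation

variable {X : Type*} [TopologicalSpace X] [T1Space X]

/-- As a right adjoint, `coinduced` need not preserve joins, so the values representing a function
are defined as joins over larger rationals; density of `ℚ` then gives the generator relation. -/
theorem biSup_gt_eq {L : Type*} [CompleteLattice L] (a : ℚ → L) (r : ℚ) :
    ⨆ p : ℚ, ⨆ _ : r < p, a p = ⨆ q : ℚ, ⨆ _ : r < q, ⨆ p : ℚ, ⨆ _ : q < p, a p := by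
  apply le_antisymm
  · refine iSup₂_le fun p hp => ?_
    obtain ⟨q, hrq, hqp⟩ := exists_between hp
    exact le_iSup₂_of_le q hrq (le_iSup₂_of_le p hqp le_rfl)
  · exact iSup₂_le fun q hq => iSup₂_le fun p hp => le_iSup₂_of_le p (hq.trans hp) le_rfl

theorem biSup_lt_eq {L : Type*} [CompleteLattice L] (b : ℚ → L) (s : ℚ) :
    ⨆ q : ℚ, ⨆ _ : q < s, b q = ⨆ p : ℚ, ⨆ _ : p < s, ⨆ q : ℚ, ⨆ _ : q < p, b q := by
  apply le_antisymm
  · refine iSup₂_le fun q hq => ?_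
    obtain ⟨p, hqp, hps⟩ := exists_between hq
    exact le_iSup₂_of_le p hps (le_iSup₂_of_le q hqp le_rfl)
  · exact iSup₂_le fun p hp => iSup₂_le fun q hq => le_iSup₂_of_le q (hq.trans hp) le_rfl

/-- The value at `(r, —)` of the function on the frame of open sets that represents `φ`. -/
def aboveValue (φ : X → EReal) (r : ℚ) : CoSub (Opens X) :=
  ⨆ p : ℚ, ⨆ _ : r < p, coinduced (superlevel φ p)

/-- The value at `(—, s)` of the function on the frame of open sets that represents `φ`. -/
def belowValue (φ : X → EReal) (s : ℚ) : CoSub (Opens X) :=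
  ⨆ q : ℚ, ⨆ _ : q < s, coinduced (sublevel φ q)

theorem omitted_aboveValue (φ : X → EReal) (r : ℚ) :
    omitted (aboveValue φ r) = superlevel φ r := by
  rw [aboveValue, superlevel_eq_iSup φ r]
  simp only [map_iSup, omitted_coinduced]

theorem omitted_belowValue (φ : X → EReal) (s : ℚ) :
    omitted (belowValue φ s) = sublevel φ s := by
  rw [belowValue, sublevel_eq_iSup φ s]
  simp only [map_iSup, omitted_coinduced]

theorem compl_aboveValue_le (φ : X → EReal) {r s : ℚ} (h : r < s) :
    (aboveValue φ r)ᶜ ≤ belowValue φ s := by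
  obtain ⟨q, hrq, hqs⟩ := exists_between h
  rw [compl_eq_coinduced, omitted_aboveValue]
  exact le_iSup₂_of_le q hqs (gc_omitted_coinduced.monotone_u (compl_superlevel_subset φ hrq))

theorem compl_belowValue_le (φ : X → EReal) {r s : ℚ} (h : r < s) :
    (belowValue φ s)ᶜ ≤ aboveValue φ r := by
  obtain ⟨q, hrq, hqs⟩ := exists_between h
  rw [compl_eq_coinduced, omitted_belowValue]
  exact le_iSup₂_of_le q hrq (gc_omitted_coinduced.monotone_u (compl_sublevel_subset φ hqs))

theorem exists_representation (φ : X → EReal) : ∃ f : ExtRealFun (Opens X),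
    (∀ r, f.1.toHom (above r) = aboveValue φ r) ∧
      ∀ s, f.1.toHom (below s) = belowValue φ s := by
  obtain ⟨f, hf, hf'⟩ := ExtPartialFun.exists_hom_of_values
    (a := aboveValue φ) (b := belowValue φ)
    (fun r s h => by
      -- By density, disjointness is checked on the level sets.
      rw [← omitted_eq_empty_iff, map_inf, omitted_aboveValue, omitted_belowValue]
      exact superlevel_inter_sublevel φ h)
    (fun r => biSup_gt_eq _ r) (fun s => biSup_lt_eq _ s)
  refine ⟨⟨f, fun r s h => ?_⟩, hf, hf'⟩
  rw [hf, hf']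
  exact ⟨compl_aboveValue_le φ h, compl_belowValue_le φ h⟩

/-- The function on the frame of open sets that represents an extended real function. -/
noncomputable def represent (φ : X → EReal) : ExtRealFun (Opens X) :=
  (exists_representation φ).choose

theorem represent_above (φ : X → EReal) (r : ℚ) :
    (represent φ).1.toHom (above r) = aboveValue φ r :=
  (exists_representation φ).choose_spec.1 r

theorem represent_below (φ : X → EReal) (s : ℚ) :
    (represent φ).1.toHom (below s) = belowValue φ s :=
  (exists_representation φ).choose_spec.2 s

theorem represent_le_iff {φ ψ : X → EReal} : represent φ ≤ represent ψ ↔ φ ≤ ψ := by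
  refine Subtype.coe_le_coe.symm.trans (ExtPartialFun.le_iff.trans ?_)
  simp only [represent_above, represent_below]
  constructor
  · rintro ⟨h, -⟩
    refine le_of_superlevel_subset fun r => ?_
    rw [← omitted_aboveValue φ r, ← omitted_aboveValue ψ r]
    exact OrderHomClass.mono omitted (h r)
  · exact fun h =>
      ⟨fun r => iSup₂_mono fun p _ => gc_omitted_coinduced.monotone_u (superlevel_mono h p),
        fun s => iSup₂_mono fun q _ => gc_omitted_coinduced.monotone_u (sublevel_anti h q)⟩

/-- One inequality is the unit of the adjunction. For the other, take `r < q < p`: since `f(p, —)`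
and `f(—, q)` are disjoint, `coinduced (omitted f(p, —)) ≤ f(—, q)*`, which Hausdorff continuity
bounds by `f(r, —)`. -/
theorem ExtRealFun.above_eq_iSup (f : ExtRealFun (Opens X)) (r : ℚ) :
    f.1.toHom (above r) = ⨆ p : ℚ, ⨆ _ : r < p, coinduced (omitted (f.1.toHom (above p))) := by
  apply le_antisymm
  · rw [f.1.above_eq_iSup r]
    exact iSup₂_mono fun p _ => gc_omitted_coinduced.le_u_l _
  · refine iSup₂_le fun p hp => ?_
    obtain ⟨q, hrq, hqp⟩ := exists_between hp
    refine le_trans ?_ (f.2 r q hrq).2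
    rw [compl_eq_coinduced]
    refine gc_omitted_coinduced.monotone_u (Set.subset_compl_iff_disjoint_right.2 ?_)
    rw [Set.disjoint_iff_inter_eq_empty]
    have := congrArg omitted (f.1.above_inf_below hqp.le)
    rwa [map_inf, map_bot] at this

theorem ExtRealFun.below_eq_iSup (f : ExtRealFun (Opens X)) (s : ℚ) :
    f.1.toHom (below s) = ⨆ q : ℚ, ⨆ _ : q < s, coinduced (omitted (f.1.toHom (below q))) := by
  apply le_antisymm
  · rw [f.1.below_eq_iSup s]
    exact iSup₂_mono fun p _ => gc_omitted_coinduced.le_u_l _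
  · refine iSup₂_le fun q hq => ?_
    obtain ⟨p, hqp, hps⟩ := exists_between hq
    refine le_trans ?_ (f.2 p s hps).1
    rw [compl_eq_coinduced]
    refine gc_omitted_coinduced.monotone_u (Set.subset_compl_iff_disjoint_right.2 ?_)
    rw [Set.disjoint_iff_inter_eq_empty, Set.inter_comm]
    have := congrArg omitted (f.1.above_inf_below hqp.le)
    rwa [map_inf, map_bot] at this

theorem represent_surjective : Function.Surjective (represent (X := X)) := by
  intro f
  obtain ⟨φ, hA, hB⟩ := exists_level_eq
    (A := fun r => omitted (f.1.toHom (above r))) (B := fun s => omitted (f.1.toHom (below s)))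
    (fun r s h => by
      have := congrArg omitted (f.1.above_inf_below h)
      rwa [map_inf, map_bot] at this)
    (fun r => by
      conv_lhs => rw [f.1.above_eq_iSup r]
      simp only [map_iSup])
    (fun s => by
      conv_lhs => rw [f.1.below_eq_iSup s]
      simp only [map_iSup])
    (fun r s h => by
      have := OrderHomClass.mono omitted (f.2 r s h).1
      rwa [compl_eq_coinduced, omitted_coinduced] at this)
  refine ⟨φ, Subtype.ext (ExtPartialFun.ext_of_values (fun r => ?_) fun s => ?_)⟩
  · rw [represent_above, aboveValue, hA, ← ExtRealFun.above_eq_iSup]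
  · rw [represent_below, belowValue, hB, ← ExtRealFun.below_eq_iSup]

variable (X) in
/-- Extended real functions on a `T₁`-space are the same as extended real functions on its frame of
open sets. -/
noncomputable def representIso : (X → EReal) ≃o ExtRealFun (Opens X) :=
  RelIso.ofSurjective (OrderEmbedding.ofMapLEIff represent fun _ _ => represent_le_iff)
    represent_surjective

theorem represent_injective : Function.Injective (represent (X := X)) := (representIso X).injective

/-! ### Semicontinuity -/

theorem represent_isLowerSemicontinuous {φ : X → EReal} :
    (represent φ).IsLowerSemicontinuous ↔ LowerSemicontinuous φ := by
  rw [lowerSemicontinuous_iff_superlevel]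
  constructor
  · rintro ⟨-, h⟩ r
    obtain ⟨U, hU⟩ := h r
    rw [← omitted_aboveValue, ← represent_above, hU, omitted_closedSublocale]
    exact U.isOpen
  · intro h
    have hc (p : ℚ) : coinduced (superlevel φ p) =
        OrderDual.toDual (closedSublocale (⟨superlevel φ p, h p⟩ : Opens X)) :=
      coinduced_coe ⟨superlevel φ p, h p⟩
    refine ⟨fun r s hrs => ?_, fun r =>
      ⟨⨆ p : ℚ, ⨆ _ : r < p, ⟨superlevel φ p, h p⟩, ?_⟩⟩
    -- Two intermediate rationals are needed: `r < p` and `q < s` select terms of the two joins, and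
    -- `p < q` makes the chosen level sets cover `X`.
    · obtain ⟨p, hrp, hps⟩ := exists_between hrs
      obtain ⟨q, hpq, hqs⟩ := exists_between hps
      rw [represent_above, represent_below, ← top_le_iff,
        ← coinduced_sup_eq_top (U := ⟨superlevel φ p, h p⟩) (compl_sublevel_subset φ hpq), ← hc]
      exact sup_le_sup (le_iSup₂_of_le p hrp le_rfl) (le_iSup₂_of_le q hqs le_rfl)
    · simp only [represent_above, aboveValue, hc, iSup_toDual_closedSublocale]

theorem represent_isUpperSemicontinuous {φ : X → EReal} :
    (represent φ).IsUpperSemicontinuous ↔ UpperSemicontinuous φ := by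
  rw [upperSemicontinuous_iff_sublevel]
  constructor
  · rintro ⟨-, h⟩ s
    obtain ⟨U, hU⟩ := h s
    rw [← omitted_belowValue, ← represent_below, hU, omitted_closedSublocale]
    exact U.isOpen
  · intro h
    have hc (q : ℚ) : coinduced (sublevel φ q) =
        OrderDual.toDual (closedSublocale (⟨sublevel φ q, h q⟩ : Opens X)) :=
      coinduced_coe ⟨sublevel φ q, h q⟩
    refine ⟨fun r s hrs => ?_, fun s =>
      ⟨⨆ q : ℚ, ⨆ _ : q < s, ⟨sublevel φ q, h q⟩, ?_⟩⟩
    · obtain ⟨p, hrp, hps⟩ := exists_between hrs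
      obtain ⟨q, hpq, hqs⟩ := exists_between hps
      rw [represent_above, represent_below, sup_comm, ← top_le_iff,
        ← coinduced_sup_eq_top (U := ⟨sublevel φ q, h q⟩) (compl_superlevel_subset φ hpq), ← hc]
      exact sup_le_sup (le_iSup₂_of_le q hqs le_rfl) (le_iSup₂_of_le p hrp le_rfl)
    · simp only [represent_below, belowValue, hc, iSup_toDual_closedSublocale]

/-! ### Real-valued functions -/

theorem isTop_plusInfty (L : Type*) [Order.Frame L] : IsTop (ExtRealFun.plusInfty L) := by
  refine fun f => ExtPartialFun.le_iff.2 ⟨fun r => ?_, fun s => ?_⟩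
  · exact le_top.trans_eq (ExtPartialFun.const_above ⊤ ⊥ (by simp) r).symm
  · exact (ExtPartialFun.const_below ⊤ ⊥ (by simp) s).trans_le bot_le

theorem isBot_minusInfty (L : Type*) [Order.Frame L] : IsBot (ExtRealFun.minusInfty L) := by
  refine fun f => ExtPartialFun.le_iff.2 ⟨fun r => ?_, fun s => ?_⟩
  · exact (ExtPartialFun.const_above ⊥ ⊤ (by simp) r).trans_le bot_le
  · exact le_top.trans_eq (ExtPartialFun.const_below ⊥ ⊤ (by simp) s).symm

theorem represent_top : represent (⊤ : X → EReal) = ExtRealFun.plusInfty (Opens X) := by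
  obtain ⟨ψ, hψ⟩ := represent_surjective (ExtRealFun.plusInfty (Opens X))
  exact le_antisymm (isTop_plusInfty _ _) (hψ ▸ represent_le_iff.2 le_top)

theorem represent_bot : represent (⊥ : X → EReal) = ExtRealFun.minusInfty (Opens X) := by
  obtain ⟨ψ, hψ⟩ := represent_surjective (ExtRealFun.minusInfty (Opens X))
  exact le_antisymm (hψ ▸ represent_le_iff.2 bot_le) (isBot_minusInfty _ _)

theorem isLUB_represent_iff {φ ψ χ : X → EReal} :
    IsLUB {represent φ, represent ψ} (represent χ) ↔ φ ⊔ ψ = χ := by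
  have h := (representIso X).isLUB_image' (s := {φ, ψ}) (x := χ)
  rw [Set.image_pair] at h
  exact h.trans ⟨fun h' => isLUB_pair.unique h', fun h' => h' ▸ isLUB_pair⟩

theorem isGLB_represent_iff {φ ψ χ : X → EReal} :
    IsGLB {represent φ, represent ψ} (represent χ) ↔ φ ⊓ ψ = χ := by
  have h := (representIso X).isGLB_image' (s := {φ, ψ}) (x := χ)
  rw [Set.image_pair] at h
  exact h.trans ⟨fun h' => isGLB_pair.unique h', fun h' => h' ▸ isGLB_pair⟩

/-- A value of a function into a bounded linear order differs from `⊤` everywhere iff the function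
has only trivial joins with value `⊤`. -/
theorem forall_ne_top_iff {α β : Type*} [LinearOrder β] [BoundedOrder β] [Nontrivial β]
    {φ : α → β} : (∀ x, φ x ≠ ⊤) ↔ ∀ ψ : α → β, φ ⊔ ψ = ⊤ → ψ = ⊤ := by
  classical
  constructor
  · intro h ψ hψ
    funext x
    exact (max_eq_top.1 (congrFun hψ x)).resolve_left (h x)
  · intro h x hx
    -- The test function is `⊤` except at `x`, so its join with `φ` is `⊤` exactly when `φ x = ⊤`.
    have key := h (Function.update ⊤ x ⊥) (funext fun y => ?_)
    · have := congrFun key x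
      simp at this
    · by_cases hy : y = x
      · subst hy
        simp [hx]
      · simp [hy]

theorem represent_isRealValued {φ : X → EReal} :
    (represent φ).IsRealValued ↔ ∀ x, φ x ≠ ⊤ ∧ φ x ≠ ⊥ := by
  rw [forall_and, forall_ne_top_iff,
    -- The condition on `-∞` is the condition on `+∞` read in the dual order.
    show (∀ x, φ x ≠ ⊥) ↔ _ from forall_ne_top_iff (β := ERealᵒᵈ) (φ := φ)]
  refine and_congr ?_ ?_
  · rw [represent_surjective.forall]
    simp only [← represent_top, isLUB_represent_iff, represent_injective.eq_iff]
  · rw [represent_surjective.forall]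
    simp only [← represent_bot, isGLB_represent_iff, represent_injective.eq_iff]
    rfl

variable (X) in
/-- Real functions on a `T₁`-space are the same as real functions on its frame of open sets. -/
noncomputable def representRealIso : (X → ℝ) ≃o RealFun (Opens X) :=
  RelIso.ofSurjective
    (OrderEmbedding.ofMapLEIff
      (fun φ => ⟨represent fun x => (φ x : EReal), represent_isRealValued.2 fun x =>
        ⟨EReal.coe_ne_top _, EReal.coe_ne_bot _⟩⟩)
      fun φ ψ => by
        refine Subtype.coe_le_coe.symm.trans (represent_le_iff.trans ?_)
        exact forall_congr' fun x => EReal.coe_le_coe_iff)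
    (by
      rintro ⟨f, hf⟩
      obtain ⟨φ, rfl⟩ := represent_surjective f
      have h := represent_isRealValued.1 hf
      refine ⟨fun x => (φ x).toReal, Subtype.ext (congrArg represent (funext fun x => ?_))⟩
      exact EReal.coe_toReal (h x).1 (h x).2)

end Representation

/-! ### Density of semicontinuous functions -/

/-- Points are closed, so near any `y ≠ x` the function is constantly `⊥`; at `x` it takes its
largest value. -/
theorem upperSemicontinuous_update_bot {X β : Type*} [TopologicalSpace X] [T1Space X]
    [DecidableEq X] [LinearOrder β] [OrderBot β] (x : X) (b : β) :
    UpperSemicontinuous (Function.update (⊥ : X → β) x b) := by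
  intro y c hc
  have hbot : ⊥ < c := bot_le.trans_lt hc
  by_cases hy : y = x
  · subst hy
    rw [Function.update_self] at hc
    refine Filter.Eventually.of_forall fun z => ?_
    by_cases hz : z = y
    · subst hz
      simpa using hc
    · simpa [hz] using hbot
  · filter_upwards [isOpen_compl_singleton.mem_nhds (Set.mem_compl_singleton_iff.2 hy)] with z hz
    have hz' : z ≠ x := hz
    simpa [hz'] using hbot

theorem lowerSemicontinuous_update_top {X β : Type*} [TopologicalSpace X] [T1Space X]
    [DecidableEq X] [LinearOrder β] [OrderTop β] (x : X) (b : β) :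
    LowerSemicontinuous (Function.update (⊤ : X → β) x b) :=
  upperSemicontinuous_update_bot (β := βᵒᵈ) x b

/-- Upper semicontinuous functions alone are join-dense and lower semicontinuous ones alone
meet-dense: the function equal to `φ x` at `x` and `⊥` (or `⊤`) elsewhere attains the value of `φ`
at `x`. -/
theorem isDedekindMacNeilleCompletion_semicontinuous (X : Type*) [TopologicalSpace X] [T1Space X] :
    IsDedekindMacNeilleCompletion
      (OrderEmbedding.subtype
        fun φ : X → EReal => LowerSemicontinuous φ ∨ UpperSemicontinuous φ) where
  join_dense φ := by
    classical
    refine ⟨{ψ | ψ.1 ≤ φ}, le_antisymm (fun x => ?_) (sSup_le ?_)⟩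
    · have hle : Function.update ⊥ x (φ x) ≤ φ :=
        update_le_iff.2 ⟨le_rfl, fun _ _ => bot_le⟩
      have := le_sSup (Set.mem_image_of_mem (OrderEmbedding.subtype _)
        (show (⟨Function.update ⊥ x (φ x), .inr (upperSemicontinuous_update_bot x _)⟩ :
          {φ : X → EReal // LowerSemicontinuous φ ∨ UpperSemicontinuous φ}) ∈ {ψ | ψ.1 ≤ φ}
          from hle)) x
      simpa using this
    · rintro _ ⟨ψ, hψ, rfl⟩
      exact hψ
  meet_dense φ := by
    classical
    refine ⟨{ψ | φ ≤ ψ.1}, le_antisymm (le_sInf ?_) (fun x => ?_)⟩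
    · rintro _ ⟨ψ, hψ, rfl⟩
      exact hψ
    · have hle : φ ≤ Function.update ⊤ x (φ x) :=
        le_update_iff.2 ⟨le_rfl, fun _ _ => le_top⟩
      have := sInf_le (Set.mem_image_of_mem (OrderEmbedding.subtype _)
        (show (⟨Function.update ⊤ x (φ x), .inl (lowerSemicontinuous_update_top x _)⟩ :
          {φ : X → EReal // LowerSemicontinuous φ ∨ UpperSemicontinuous φ}) ∈ {ψ | φ ≤ ψ.1}
          from hle)) x
      simpa using this

end PointfreeReal

theorem mainTheorem5 (X : Type*) [TopologicalSpace X] [T1Space X] :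
    PointfreeReal.IsDedekindMacNeilleCompletion
      (OrderEmbedding.subtype
        fun φ : X → EReal => LowerSemicontinuous φ ∨ UpperSemicontinuous φ) ∧
    ∃ e : (X → EReal) ≃o PointfreeReal.ExtRealFun (TopologicalSpace.Opens X),
      (∀ φ, (e φ).IsLowerSemicontinuous ↔ LowerSemicontinuous φ) ∧
      (∀ φ, (e φ).IsUpperSemicontinuous ↔ UpperSemicontinuous φ) ∧
      ∃ e' : (X → ℝ) ≃o PointfreeReal.RealFun (TopologicalSpace.Opens X),
        ∀ φ : X → ℝ, (e' φ).1 = e fun x => (φ x : EReal) :=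
  ⟨PointfreeReal.isDedekindMacNeilleCompletion_semicontinuous X, PointfreeReal.representIso X,
    fun _ => PointfreeReal.represent_isLowerSemicontinuous,
    fun _ => PointfreeReal.represent_isUpperSemicontinuous,
    PointfreeReal.representRealIso X, fun _ => rfl⟩
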